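/- Let $G=(V,E)$ be a finite graph (loops and multiple edges allowed) with total orders on $V$ and on $E$. For $S\subseteq E$ let $[G:S]$ be the spanning subgraph with edge set $S$ and let $k([G:S])$ be the number of its connected components. The graphic matroid $M(G)$ is the matroid on $E$ with rank function $S\mapsto |V|-k([G:S])$. Let $\tilde N=\mathbb Z^V$, let $\tilde\rho(S)\subseteq\tilde N$ be the subgroup generated by the differences $v-v'$ of the endpoints of the edges in $S$, let $I_G\subseteq\tilde N$ be the subgroup generated by the least vertex of each connected component of $G$, and put $\rho(S)=(\tilde\rho(S)+I_G)/I_G$ and $N=\rho(E)=\tilde N/I_G$; this $\rho$ is the canonical $\mathbb Z$-quasi-representation of $M(G)$. Let $$C^{i,j}(M(G))=\bigoplus_{S\subseteq E,\ |S|=i}\ \bigwedge\nolimits^{j} N/\rho(S)$$ (zero if $i<0$ or $j<0$), with differential $C^{i,j}\to C^{i+1,j}$ the sum over $S$ and $e\in E\setminus S$ of $(-1)^{|\{e'\in S\,:\,e'<e\}|}$ times the map induced by the projection $N/\rho(S)\to N/\rho(S\cup e)$, and let $H^{i,j}(M(G))$ be the cohomology of this complex (the characteristic cohomology of $M(G)$).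 Let $n=|V|-k([G:E])+1=\operatorname{rank}M(G)+1$, which is the number of vertices of any connected graph $G'$ with $M(G')\cong M(G)$; in particular $n=|V|$ if $G$ is connected. Then for all integers $i,j$ with $i+j<n-1$ there is an isomorphism of abelian groups $$H^{i,j}(M(G))\cong H^{i+1,j-1}(M(G)).$$ -/

import Mathlib

open scoped BigOperators

noncomputable section

namespace CharCoh

universe u v w

/-- A matroid on the finite ground set `E`, given by its rank function. -/
structure RankMatroid (E : Type u) [DecidableEq E] where
  rk : Finset E → ℕ
  rk_le_card : ∀ S, rk S ≤ S.card
  rk_mono : ∀ ⦃S T⦄, S ⊆ T → rk S ≤ rk T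
  rk_submod : ∀ S T, rk (S ∩ T) + rk (S ∪ T) ≤ rk S + rk T

/-- An `R`-quasi-representation of the matroid `M` in the module `N`, for a principal ideal
domain `R`. For a module `P` over a domain, `Module.finrank R P` is the dimension of
`P ⊗ Frac R`. -/
structure QuasiRep (R : Type v) [CommRing R] [IsDomain R] [IsPrincipalIdealRing R]
    {E : Type u} [Fintype E] [DecidableEq E]
    (M : RankMatroid E) (N : Type w) [AddCommGroup N] [Module R N] [Module.Finite R N] where
  sub : Finset E → Submodule R N
  finrank_sub : ∀ S, Module.finrank R (sub S) = M.rk S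
  sub_empty : sub ∅ = ⊥
  sub_univ : sub Finset.univ = ⊤
  sub_mono : ∀ ⦃S T⦄, S ⊆ T → sub S ≤ sub T
  sub_eq : ∀ ⦃S T⦄, S ⊆ T → M.rk S = M.rk T → sub S = sub T

/-! ### Exterior powers with an integer exponent (zero for negative exponents) -/

section ExtPow

variable (R : Type v) [CommRing R]

/-- The `j`-th exterior power of `L`, as the degree `j` part of the exterior algebra;
it is zero for `j < 0`. -/
def extPow (L : Type w) [AddCommGroup L] [Module R L] :
    ℤ → Submodule R (ExteriorAlgebra R L)
  | Int.ofNat k => ⋀[R]^k L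
  | Int.negSucc _ => ⊥

variable {R} {L : Type*} {L' : Type*}
  [AddCommGroup L] [Module R L] [AddCommGroup L'] [Module R L']

lemma extPow_map_mem (f : L →ₗ[R] L') (j : ℤ) (x : ExteriorAlgebra R L)
    (hx : x ∈ extPow R L j) :
    (ExteriorAlgebra.map f).toLinearMap x ∈ extPow R L' j := by
  cases j with
  | ofNat k =>
    change x ∈ ⋀[R]^k L at hx
    change _ ∈ ⋀[R]^k L'
    have h : (⋀[R]^k L).map (ExteriorAlgebra.map f).toLinearMap ≤ ⋀[R]^k L' := by
      rw [Submodule.map_pow]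
      refine pow_le_pow_left' ?_ k
      rintro _ ⟨_, ⟨m, rfl⟩, rfl⟩
      exact ⟨f m, by simp⟩
    exact h ⟨x, hx, rfl⟩
  | negSucc k =>
    change x ∈ (⊥ : Submodule R _) at hx
    rw [Submodule.mem_bot] at hx
    subst hx
    simp

/-- The map induced on exterior powers by a linear map. -/
def extPowMap (f : L →ₗ[R] L') (j : ℤ) : extPow R L j →ₗ[R] extPow R L' j :=
  (ExteriorAlgebra.map f).toLinearMap.restrict (extPow_map_mem f j)

end ExtPow

/-! ### The cochain complex of a matroid with a quasi-representation -/

section Complex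

variable {R : Type v} [CommRing R] [IsDomain R] [IsPrincipalIdealRing R]
  {E : Type u} [Fintype E] [LinearOrder E]
  {M : RankMatroid E} {N : Type w} [AddCommGroup N] [Module R N] [Module.Finite R N]

/-- The sign `(-1) ^ #{e' ∈ S | e' < e}`. -/
def edgeSign (R : Type v) [CommRing R] (S : Finset E) (e : E) : R :=
  (-1) ^ (S.filter (· < e)).card

/-- The natural projection `N / ρ(S) → N / ρ(T)` for `S ⊆ T`. -/
def quotMap (ρ : QuasiRep R M N) {S T : Finset E} (h : S ⊆ T) :
    (N ⧸ ρ.sub S) →ₗ[R] (N ⧸ ρ.sub T) :=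
  Submodule.factor (ρ.sub_mono h)

/-- The chain group `C^{i,j}`: the direct sum of `⋀^j (N / ρ(S))` over all `S` with `i` elements
(a product over a finite index set). -/
def Cochain (ρ : QuasiRep R M N) (i j : ℤ) : Type (max u v w) :=
  (S : {S : Finset E // (S.card : ℤ) = i}) → extPow R (N ⧸ ρ.sub S.1) j

instance (ρ : QuasiRep R M N) (i j : ℤ) : AddCommGroup (Cochain ρ i j) :=
  inferInstanceAs (AddCommGroup
    ((S : {S : Finset E // (S.card : ℤ) = i}) → extPow R (N ⧸ ρ.sub S.1) j))

instance (ρ : QuasiRep R M N) (i j : ℤ) : Module R (Cochain ρ i j) :=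
  inferInstanceAs (Module R
    ((S : {S : Finset E // (S.card : ℤ) = i}) → extPow R (N ⧸ ρ.sub S.1) j))

/-- The component of a cochain at `S`. -/
def Cochain.component (ρ : QuasiRep R M N) (i j : ℤ) (S : {S : Finset E // (S.card : ℤ) = i}) :
    Cochain ρ i j →ₗ[R] extPow R (N ⧸ ρ.sub S.1) j :=
  LinearMap.proj S

lemma card_erase_of_card {T : Finset E} {i i' : ℤ} (h : i + 1 = i') (hT : (T.card : ℤ) = i')
    {e : E} (he : e ∈ T) : ((T.erase e).card : ℤ) = i := by
  have := Finset.card_erase_add_one he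
  omega

/-- The differential `C^{i,j} → C^{i',j}`, where `i' = i + 1`. Its component at `T` is the sum over
`e ∈ T` of the signed projections from the component at `T \ {e}`. -/
def d (ρ : QuasiRep R M N) (i i' j : ℤ) (h : i + 1 = i') :
    Cochain ρ i j →ₗ[R] Cochain ρ i' j :=
  LinearMap.pi fun T =>
    ∑ e : {e // e ∈ T.1},
      edgeSign R (T.1.erase e.1) e.1 •
        (extPowMap (quotMap ρ (Finset.erase_subset e.1 T.1)) j ∘ₗ
          Cochain.component ρ i j ⟨T.1.erase e.1, card_erase_of_card h T.2 e.2⟩)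

lemma d_apply_coe (ρ : QuasiRep R M N) (i i' j : ℤ) (h : i + 1 = i') (x : Cochain ρ i j)
    (T : {S : Finset E // (S.card : ℤ) = i'}) :
    ((d ρ i i' j h x) T).1 = ∑ e : {e // e ∈ T.1}, edgeSign R (T.1.erase e.1) e.1 •
      ExteriorAlgebra.map (quotMap ρ (Finset.erase_subset e.1 T.1))
        (x ⟨T.1.erase e.1, card_erase_of_card h T.2 e.2⟩).1 := by
  change ((∑ e : {e // e ∈ T.1}, edgeSign R (T.1.erase e.1) e.1 •
    (extPowMap (quotMap ρ (Finset.erase_subset e.1 T.1)) j ∘ₗ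
      Cochain.component ρ i j ⟨T.1.erase e.1, card_erase_of_card h T.2 e.2⟩))
        x : extPow R (N ⧸ ρ.sub T.1) j).1 = _
  rw [LinearMap.sum_apply, Submodule.coe_sum]
  rfl

/-- The characteristic cohomology `H^{i,j}(M, ρ)`: cocycles modulo coboundaries. -/
abbrev Cohomology (ρ : QuasiRep R M N) (i j : ℤ) : Type (max u v w) :=
  LinearMap.ker (d ρ i (i + 1) j rfl) ⧸
    (LinearMap.range (d ρ (i - 1) i j (sub_add_cancel i 1))).submoduleOf
      (LinearMap.ker (d ρ i (i + 1) j rfl))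

lemma edgeSign_anti (U : Finset E) {e f : E} (he : e ∈ U) (hf : f ∈ U) (hef : e ≠ f) :
    edgeSign R (U.erase e) e * edgeSign R ((U.erase e).erase f) f +
      edgeSign R (U.erase f) f * edgeSign R ((U.erase f).erase e) e = 0 := by
  wlog hlt : e < f generalizing e f
  · rw [add_comm]
    exact this hf he hef.symm (lt_of_le_of_ne (not_lt.1 hlt) hef.symm)
  have h1 : (U.erase e).filter (· < e) = ((U.erase f).erase e).filter (· < e) := by
    ext x
    simp only [Finset.mem_filter, Finset.mem_erase]
    constructor
    · rintro ⟨⟨h1, h2⟩, h3⟩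
      exact ⟨⟨h1, (h3.trans hlt).ne, h2⟩, h3⟩
    · rintro ⟨⟨h1, h2, h3⟩, h4⟩
      exact ⟨⟨h1, h3⟩, h4⟩
  have h2 : (U.erase f).filter (· < f) = insert e (((U.erase e).erase f).filter (· < f)) := by
    ext x
    simp only [Finset.mem_filter, Finset.mem_erase, Finset.mem_insert]
    constructor
    · rintro ⟨⟨h1, h2⟩, h3⟩
      by_cases hx : x = e
      · exact Or.inl hx
      · exact Or.inr ⟨⟨h1, hx, h2⟩, h3⟩
    · rintro (rfl | ⟨⟨h1, h2, h3⟩, h4⟩)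
      · exact ⟨⟨hef, he⟩, hlt⟩
      · exact ⟨⟨h1, h3⟩, h4⟩
  have h3 : e ∉ ((U.erase e).erase f).filter (· < f) := by simp
  unfold edgeSign
  rw [h1, h2, Finset.card_insert_of_notMem h3, pow_succ]
  ring

/-- The maps `d` form a complex. -/
lemma d_comp_d (ρ : QuasiRep R M N) (i i' i'' j : ℤ) (h : i + 1 = i') (h' : i' + 1 = i'') :
    d ρ i' i'' j h' ∘ₗ d ρ i i' j h = 0 := by
  classical
  apply LinearMap.ext
  intro x
  funext U
  apply Subtype.ext
  let X : Finset E → ExteriorAlgebra R (N ⧸ ρ.sub U.1) := fun S =>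
    if hS : (S.card : ℤ) = i ∧ S ⊆ U.1 then
      ExteriorAlgebra.map (quotMap ρ hS.2) (x ⟨S, hS.1⟩).1 else 0
  have key : (((d ρ i' i'' j h' ∘ₗ d ρ i i' j h) x) U).1 =
      ∑ e ∈ U.1, ∑ f ∈ U.1.erase e,
        (edgeSign R (U.1.erase e) e * edgeSign R ((U.1.erase e).erase f) f) •
          X ((U.1.erase e).erase f) := by
    rw [← Finset.sum_coe_sort U.1]
    rw [LinearMap.comp_apply, d_apply_coe]
    refine Finset.sum_congr rfl fun e _ => ?_
    rw [d_apply_coe, map_sum, Finset.smul_sum, ← Finset.sum_coe_sort (U.1.erase e)]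
    refine Finset.sum_congr rfl fun f _ => ?_
    have hS : ((((U.1.erase e).erase f.1).card : ℤ) = i ∧ (U.1.erase e).erase f.1 ⊆ U.1) :=
      ⟨card_erase_of_card h (card_erase_of_card h' U.2 e.2) f.2,
        (Finset.erase_subset _ _).trans (Finset.erase_subset _ _)⟩
    simp only [X, dif_pos hS, map_smul, smul_smul]
    congr 1
    change (ExteriorAlgebra.map _) ((ExteriorAlgebra.map _) _) = _
    rw [← AlgHom.comp_apply, ExteriorAlgebra.map_comp_map]
    congr 2
    ext n
    rfl
  rw [key, Finset.sum_sigma']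
  change _ = (0 : ExteriorAlgebra R _)
  refine Finset.sum_involution (fun p _ => ⟨p.2, p.1⟩) ?_ ?_ ?_ ?_
  · rintro ⟨e, f⟩ hp
    simp only [Finset.mem_sigma, Finset.mem_erase] at hp
    simp only
    rw [Finset.erase_right_comm (a := f) (b := e), ← add_smul]
    have := edgeSign_anti (R := R) U.1 hp.1 hp.2.2 (Ne.symm hp.2.1)
    rw [Finset.erase_right_comm (a := f) (b := e)] at this
    rw [this, zero_smul]
  · rintro ⟨e, f⟩ hp _ heq
    simp only [Finset.mem_sigma, Finset.mem_erase] at hp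
    simp only [Sigma.mk.injEq] at heq
    exact hp.2.1 heq.1
  · rintro ⟨e, f⟩ hp
    simp only [Finset.mem_sigma, Finset.mem_erase] at hp ⊢
    exact ⟨hp.2.2, Ne.symm hp.2.1, hp.1⟩
  · rintro ⟨e, f⟩ hp
    rfl

end Complex

/-! ### Graphic matroids and their canonical integral quasi-representation

Graphs are finite multigraphs: loops and parallel edges are allowed. -/

section Graphic

variable {α : Type u} {β : Type v} (G : Graph α β)

/-- Two vertices are adjacent here if they are distinct and joined by an edge in `S`. This simple
graph has the same connected components as the spanning subgraph `[G : S]`. -/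
def spanningGraph (S : Finset G.edgeSet) : SimpleGraph G.vertexSet :=
  SimpleGraph.fromRel fun x y => ∃ e ∈ S, G.IsLink e.1 x.1 y.1

/-- The set `Conn(S)` of connected components of the spanning subgraph `[G : S]`. -/
abbrev Conn (S : Finset G.edgeSet) : Type u := (spanningGraph G S).ConnectedComponent

/-- The number `k([G : S])` of connected components of the spanning subgraph `[G : S]`. -/
def numConn (S : Finset G.edgeSet) : ℕ := Nat.card (Conn G S)

/-- The rank function `|V| - k([G : S])` (there are at most `|V|` components). -/
def graphicRank (S : Finset G.edgeSet) : ℕ := Nat.card G.vertexSet - numConn G S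

/-- The submodule of `ℤ^V` spanned by the differences `x - y` of the ends of the edges in `S`. -/
def edgeSpan (S : Finset G.edgeSet) : Submodule ℤ (G.vertexSet →₀ ℤ) :=
  Submodule.span ℤ {w | ∃ e ∈ S, ∃ x y : G.vertexSet, G.IsLink e.1 x.1 y.1 ∧
    w = Finsupp.single x 1 - Finsupp.single y 1}

/-- The submodule `I_G` of `ℤ^V` spanned by the least vertices of the connected components of
`G`. -/
def rootSpan [Fintype G.edgeSet] [LinearOrder G.vertexSet] : Submodule ℤ (G.vertexSet →₀ ℤ) :=
  Submodule.span ℤ {w | ∃ F : Conn G Finset.univ, ∃ x : G.vertexSet, IsLeast F.supp x ∧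
    w = Finsupp.single x 1}

lemma numConn_le [Finite G.vertexSet] (S : Finset G.edgeSet) :
    numConn G S ≤ Nat.card G.vertexSet :=
  Nat.card_le_card_of_surjective (spanningGraph G S).connectedComponentMk Quot.mk_surjective

lemma graphicRank_add_numConn [Finite G.vertexSet] (S : Finset G.edgeSet) :
    graphicRank G S + numConn G S = Nat.card G.vertexSet :=
  Nat.sub_add_cancel (numConn_le G S)

/-- The map `ℤ^V → ℤ^Conn(S)` sending a vertex to its component. -/
def compMap (S : Finset G.edgeSet) : (G.vertexSet →₀ ℤ) →ₗ[ℤ] (Conn G S →₀ ℤ) :=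
  Finsupp.lmapDomain ℤ ℤ (spanningGraph G S).connectedComponentMk

lemma compMap_single (S : Finset G.edgeSet) (x : G.vertexSet) (a : ℤ) :
    compMap G S (Finsupp.single x a) =
      Finsupp.single ((spanningGraph G S).connectedComponentMk x) a := by
  simp [compMap]

lemma sub_mem_edgeSpan (S : Finset G.edgeSet) {x y : G.vertexSet}
    (h : (spanningGraph G S).Reachable x y) :
    Finsupp.single x (1 : ℤ) - Finsupp.single y 1 ∈ edgeSpan G S := by
  obtain ⟨p⟩ := h
  induction p with
  | nil => simp
  | cons hadj _ ih =>
    rw [← sub_add_sub_cancel]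
    refine add_mem ?_ ih
    rw [spanningGraph, SimpleGraph.fromRel_adj] at hadj
    obtain ⟨-, ⟨e, he, hl⟩ | ⟨e, he, hl⟩⟩ := hadj
    · exact Submodule.subset_span ⟨e, he, _, _, hl, rfl⟩
    · exact Submodule.subset_span ⟨e, he, _, _, hl.symm, rfl⟩

lemma edgeSpan_eq_ker (S : Finset G.edgeSet) : edgeSpan G S = LinearMap.ker (compMap G S) := by
  apply le_antisymm
  · refine Submodule.span_le.2 ?_
    rintro _ ⟨e, he, x, y, hl, rfl⟩
    have : (spanningGraph G S).Reachable x y := by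
      by_cases hxy : x = y
      · rw [hxy]
      · refine SimpleGraph.Adj.reachable ?_
        rw [spanningGraph, SimpleGraph.fromRel_adj]
        exact ⟨hxy, Or.inl ⟨e, he, hl⟩⟩
    rw [SetLike.mem_coe, LinearMap.mem_ker, map_sub, compMap_single, compMap_single,
      SimpleGraph.ConnectedComponent.eq.2 this, sub_self]
  · intro z hz
    let r : Conn G S → G.vertexSet := Quot.out
    have hr : ∀ x, (spanningGraph G S).Reachable x
        (r ((spanningGraph G S).connectedComponentMk x)) := fun x =>
      SimpleGraph.ConnectedComponent.eq.1 (Quot.out_eq _).symm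
    have h1 : ∀ z : G.vertexSet →₀ ℤ,
        z - Finsupp.lmapDomain ℤ ℤ r (compMap G S z) ∈ edgeSpan G S := by
      intro z
      induction z using Finsupp.induction_linear with
      | zero => simp
      | add a b ha hb =>
        have := add_mem ha hb
        rw [map_add, map_add]
        convert this using 1
        abel
      | single x a =>
        have := Submodule.smul_mem _ a (sub_mem_edgeSpan G S (hr x))
        rw [compMap_single]
        simpa [smul_sub] using this
    have := h1 z
    rw [LinearMap.mem_ker] at hz
    rwa [hz, map_zero, sub_zero] at this

lemma finrank_edgeSpan [Finite G.vertexSet] (S : Finset G.edgeSet) :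
    Module.finrank ℤ (edgeSpan G S) = graphicRank G S := by
  classical
  have := Fintype.ofFinite G.vertexSet
  have := Fintype.ofFinite (Conn G S)
  have h := (LinearMap.ker (compMap G S)).finrank_quotient_add_finrank
  have hs : Function.Surjective (compMap G S) :=
    Finsupp.mapDomain_surjective Quot.mk_surjective
  rw [((compMap G S).quotKerEquivOfSurjective hs).finrank_eq, Module.finrank_finsupp_self,
    Module.finrank_finsupp_self, ← edgeSpan_eq_ker] at h
  have h2 := graphicRank_add_numConn G S
  rw [numConn, Nat.card_eq_fintype_card, Nat.card_eq_fintype_card] at h2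
  omega

lemma edgeSpan_mono {S T : Finset G.edgeSet} (h : S ⊆ T) : edgeSpan G S ≤ edgeSpan G T :=
  Submodule.span_mono fun _ ⟨e, he, hx⟩ => ⟨e, h he, hx⟩

lemma edgeSpan_empty : edgeSpan G ∅ = ⊥ := by
  simp [edgeSpan]

lemma edgeSpan_union [DecidableEq G.edgeSet] (S T : Finset G.edgeSet) :
    edgeSpan G (S ∪ T) = edgeSpan G S ⊔ edgeSpan G T := by
  rw [edgeSpan, edgeSpan, edgeSpan, ← Submodule.span_union]
  congr 1
  ext w
  simp only [Finset.mem_union, Set.mem_union, Set.mem_ofPred_eq]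
  constructor
  · rintro ⟨e, he | he, h⟩
    · exact Or.inl ⟨e, he, h⟩
    · exact Or.inr ⟨e, he, h⟩
  · rintro (⟨e, he, h⟩ | ⟨e, he, h⟩)
    · exact ⟨e, Or.inl he, h⟩
    · exact ⟨e, Or.inr he, h⟩

lemma finrank_edgeSpan_le_card [Finite G.vertexSet] (S : Finset G.edgeSet) :
    Module.finrank ℤ (edgeSpan G S) ≤ S.card := by
  classical
  have hex : ∀ e : G.edgeSet, ∃ p : G.vertexSet × G.vertexSet, G.IsLink e.1 p.1.1 p.2.1 := by
    intro e
    obtain ⟨x, y, h⟩ := Graph.exists_isLink_of_mem_edgeSet e.2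
    exact ⟨⟨⟨x, h.left_mem⟩, ⟨y, h.right_mem⟩⟩, h⟩
  choose p hp using hex
  let f : G.edgeSet → (G.vertexSet →₀ ℤ) := fun e =>
    Finsupp.single (p e).1 1 - Finsupp.single (p e).2 1
  have : edgeSpan G S = Submodule.span ℤ ((S.image f : Finset _) : Set (G.vertexSet →₀ ℤ)) := by
    apply le_antisymm
    · refine Submodule.span_le.2 ?_
      rintro _ ⟨e, he, x, y, hl, rfl⟩
      have hf : f e ∈ Submodule.span ℤ ((S.image f : Finset _) : Set (G.vertexSet →₀ ℤ)) :=
        Submodule.subset_span (Finset.mem_coe.2 (Finset.mem_image_of_mem f he))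
      rcases hl.eq_and_eq_or_eq_and_eq (hp e) with ⟨h1, h2⟩ | ⟨h1, h2⟩
      · rw [Subtype.ext h1, Subtype.ext h2]
        exact hf
      · rw [Subtype.ext h1, Subtype.ext h2]
        have := neg_mem hf
        simpa [f] using this
    · refine Submodule.span_le.2 ?_
      intro w hw
      obtain ⟨e, he, rfl⟩ := Finset.mem_image.1 (Finset.mem_coe.1 hw)
      exact Submodule.subset_span ⟨e, he, _, _, hp e, rfl⟩
  rw [this]
  exact (finrank_span_finset_le_card _).trans Finset.card_image_le

/-- The graphic matroid `M(G)` of a finite graph `G`. -/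
def graphicMatroid [Finite G.vertexSet] [DecidableEq G.edgeSet] : RankMatroid G.edgeSet where
  rk := graphicRank G
  rk_le_card S := by
    rw [← finrank_edgeSpan]
    exact finrank_edgeSpan_le_card G S
  rk_mono S T h := by
    rw [← finrank_edgeSpan, ← finrank_edgeSpan]
    exact Submodule.finrank_mono (edgeSpan_mono G h)
  rk_submod S T := by
    have h1 := Submodule.rank_sup_add_rank_inf_eq (edgeSpan G S) (edgeSpan G T)
    rw [← edgeSpan_union] at h1
    simp only [← Module.finrank_eq_rank] at h1
    have h2 : Module.finrank ℤ (edgeSpan G (S ∩ T)) ≤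
        Module.finrank ℤ (edgeSpan G S ⊓ edgeSpan G T : Submodule ℤ (G.vertexSet →₀ ℤ)) :=
      Submodule.finrank_mono (le_inf (edgeSpan_mono G Finset.inter_subset_left)
        (edgeSpan_mono G Finset.inter_subset_right))
    have h3 := h1
    norm_cast at h3
    simp only [finrank_edgeSpan] at h2 h3
    omega

lemma edgeSpan_eq_of_rank_eq [Finite G.vertexSet] {S T : Finset G.edgeSet} (h : S ⊆ T)
    (hr : graphicRank G S = graphicRank G T) : edgeSpan G S = edgeSpan G T := by
  refine le_antisymm (edgeSpan_mono G h) ?_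
  have hle : spanningGraph G S ≤ spanningGraph G T := by
    intro x y hxy
    rw [spanningGraph, SimpleGraph.fromRel_adj] at hxy ⊢
    refine ⟨hxy.1, hxy.2.imp ?_ ?_⟩
    · rintro ⟨e, he, hl⟩
      exact ⟨e, h he, hl⟩
    · rintro ⟨e, he, hl⟩
      exact ⟨e, h he, hl⟩
  let g : Conn G S → Conn G T := SimpleGraph.ConnectedComponent.map (SimpleGraph.Hom.ofLE hle)
  have hg : ∀ x, g ((spanningGraph G S).connectedComponentMk x) =
      (spanningGraph G T).connectedComponentMk x := fun x => rfl
  have hsurj : Function.Surjective g := by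
    intro F
    induction F using SimpleGraph.ConnectedComponent.ind with
    | _ x => exact ⟨_, hg x⟩
  have hcard : Nat.card (Conn G S) = Nat.card (Conn G T) := by
    have h1 := graphicRank_add_numConn G S
    have h2 := graphicRank_add_numConn G T
    rw [numConn] at h1 h2
    omega
  have hinj : Function.Injective g :=
    ((Nat.bijective_iff_surjective_and_card g).2 ⟨hsurj, hcard⟩).1
  refine Submodule.span_le.2 ?_
  rintro _ ⟨e, he, x, y, hl, rfl⟩
  apply sub_mem_edgeSpan
  apply SimpleGraph.ConnectedComponent.eq.1
  apply hinj
  rw [hg, hg]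
  apply SimpleGraph.ConnectedComponent.eq.2
  by_cases hxy : x = y
  · rw [hxy]
  · refine SimpleGraph.Adj.reachable ?_
    rw [spanningGraph, SimpleGraph.fromRel_adj]
    exact ⟨hxy, Or.inl ⟨e, he, hl⟩⟩

lemma exists_isLeast [Finite G.vertexSet] [LinearOrder G.vertexSet] {S : Finset G.edgeSet}
    (F : Conn G S) : ∃ x, IsLeast F.supp x := by
  obtain ⟨x, hx, h⟩ := Set.exists_min_image F.supp id (Set.toFinite _) F.nonempty_supp
  exact ⟨x, hx, h⟩

lemma edgeSpan_inf_rootSpan [Finite G.vertexSet] [LinearOrder G.vertexSet] [Fintype G.edgeSet]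
    (S : Finset G.edgeSet) : edgeSpan G S ⊓ rootSpan G = ⊥ := by
  choose r hr using fun F : Conn G Finset.univ => exists_isLeast G F
  have hI : rootSpan G ≤ LinearMap.range (Finsupp.lmapDomain ℤ ℤ r) := by
    refine Submodule.span_le.2 ?_
    rintro _ ⟨F, x, hx, rfl⟩
    refine ⟨Finsupp.single F 1, ?_⟩
    rw [hx.unique (hr F)]
    simp
  have hsec : ∀ z, compMap G Finset.univ (Finsupp.lmapDomain ℤ ℤ r z) = z := by
    intro z
    rw [compMap, Finsupp.lmapDomain_apply, Finsupp.lmapDomain_apply, ← Finsupp.mapDomain_comp]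
    convert Finsupp.mapDomain_id
    funext F
    exact (hr F).1
  rw [eq_bot_iff]
  rintro y ⟨h1, h2⟩
  have h3 := edgeSpan_mono G (Finset.subset_univ S) h1
  rw [edgeSpan_eq_ker, LinearMap.mem_ker] at h3
  obtain ⟨z, rfl⟩ := hI h2
  rw [hsec] at h3
  rw [h3, map_zero]
  exact Submodule.zero_mem _

lemma edgeSpan_sup_rootSpan [Finite G.vertexSet] [LinearOrder G.vertexSet] [Fintype G.edgeSet] :
    edgeSpan G Finset.univ ⊔ rootSpan G = ⊤ := by
  refine (Submodule.eq_top_iff').2 fun z => ?_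
  induction z using Finsupp.induction_linear with
  | zero => exact Submodule.zero_mem _
  | add a b ha hb => exact add_mem ha hb
  | single x a =>
    obtain ⟨r, hr⟩ := exists_isLeast G ((spanningGraph G Finset.univ).connectedComponentMk x)
    have h1 : (spanningGraph G Finset.univ).Reachable x r :=
      SimpleGraph.ConnectedComponent.eq.1 hr.1.symm
    have h2 := Submodule.mem_sup_left (T := rootSpan G) (sub_mem_edgeSpan G Finset.univ h1)
    have h3 : Finsupp.single r (1 : ℤ) ∈ edgeSpan G Finset.univ ⊔ rootSpan G :=
      Submodule.mem_sup_right (Submodule.subset_span ⟨_, r, hr, rfl⟩)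
    have h4 := Submodule.smul_mem _ a (add_mem h2 h3)
    simpa using h4

/-- The canonical `ℤ`-quasi-representation of `M(G)`: the module is `N = ℤ^V / I_G`, and
`ρ(S)` is the image in `N` of the span of the differences of the ends of the edges in `S`. -/
def canonicalRep [Finite G.vertexSet] [LinearOrder G.vertexSet] [Fintype G.edgeSet]
    [DecidableEq G.edgeSet] :
    QuasiRep ℤ (graphicMatroid G) ((G.vertexSet →₀ ℤ) ⧸ rootSpan G) where
  sub S := (edgeSpan G S).map (rootSpan G).mkQ
  finrank_sub S := by
    change _ = graphicRank G S
    rw [← finrank_edgeSpan]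
    refine (LinearEquiv.finrank_eq (LinearEquiv.ofBijective
      ((rootSpan G).mkQ.submoduleMap (edgeSpan G S)) ⟨?_, LinearMap.submoduleMap_surjective _ _⟩)).symm
    rw [injective_iff_map_eq_zero]
    rintro ⟨x, hx⟩ h
    have h1 : (rootSpan G).mkQ x = 0 := congrArg Subtype.val h
    have h2 : x ∈ edgeSpan G S ⊓ rootSpan G :=
      ⟨hx, by simpa [Submodule.Quotient.mk_eq_zero] using h1⟩
    rw [edgeSpan_inf_rootSpan, Submodule.mem_bot] at h2
    exact Subtype.ext h2
  sub_empty := by rw [edgeSpan_empty, Submodule.map_bot]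
  sub_univ := by
    rw [← Submodule.comap_injective_of_surjective (rootSpan G).mkQ_surjective |>.eq_iff,
      Submodule.comap_map_mkQ, sup_comm, edgeSpan_sup_rootSpan, Submodule.comap_top]
  sub_mono S T h := Submodule.map_mono (edgeSpan_mono G h)
  sub_eq S T h hr := by rw [edgeSpan_eq_of_rank_eq G h hr]

/-- The characteristic cohomology `H^{i,j}(M(G))` of the graphic matroid `M(G)` with its canonical
integral quasi-representation. -/
abbrev graphicCohomology [Finite G.vertexSet] [LinearOrder G.vertexSet] [Fintype G.edgeSet]
    [LinearOrder G.edgeSet] (i j : ℤ) : Type (max u v) :=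
  Cohomology (canonicalRep G) i j

end Graphic

end CharCoh

end

/-!
In total degree below the rank of the matroid the cohomology vanishes altogether, because each
`N / ρ(S)` is torsion-free and `ρ(S ∪ T) = ρ(S) + ρ(T)`. This is shown by deletion and contraction
of the largest element `e`. Contracting `e` lowers the rank by at most one and the cardinality
degree by one, so if `e` is not a coloop then exactness is inherited from the deletion and the
contraction. If `e` is a coloop, the deletion has smaller rank and no longer helps. Then `ρ(e)` is
spanned by a vector `v` on which some functional vanishing on the other elements takes the value 1,
and multiplication by `v` identifies the kernel of `⋀ʲ (N / ρ(S)) → ⋀ʲ (N / ρ(S ∪ e))` with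
`⋀ʲ⁻¹ (N / ρ(S ∪ e))`; hence exactness of the contraction in exterior degree `j - 1` suffices.
-/

namespace CharCoh

noncomputable section

universe u v w

section ExteriorPowers

variable {R : Type v} [CommRing R] {N : Type w} [AddCommGroup N] [Module R N]
  {L : Type*} [AddCommGroup L] [Module R L]

open ExteriorAlgebra in
lemma ι_mul_mem_extPow (v : N) {j : ℤ} {x : ExteriorAlgebra R N} (hx : x ∈ extPow R N (j - 1)) :
    ι R v * x ∈ extPow R N j := by
  obtain ⟨k, rfl⟩ | hj := em (∃ k : ℕ, j = k + 1)
  · rw [add_sub_cancel_right] at hx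
    change _ ∈ LinearMap.range (ι R) ^ (k + 1)
    rw [pow_succ']
    exact Submodule.mul_mem_mul ⟨v, rfl⟩ hx
  · have hneg : j - 1 < 0 := by
      by_contra! h
      exact hj ⟨(j - 1).toNat, by omega⟩
    obtain ⟨k, hk⟩ := Int.eq_negSucc_of_lt_zero hneg
    rw [hk] at hx
    rw [(Submodule.mem_bot R).1 hx, mul_zero]
    exact zero_mem _

open ExteriorAlgebra in
lemma contractLeft_mem_extPow (φ : Module.Dual R N) {j : ℤ} {x : ExteriorAlgebra R N}
    (hx : x ∈ extPow R N j) :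
    CliffordAlgebra.contractLeft (Q := (0 : QuadraticForm R N)) φ x ∈ extPow R N (j - 1) := by
  cases j with
  | negSucc k =>
    rw [(Submodule.mem_bot R).1 hx, map_zero]
    exact zero_mem _
  | ofNat k =>
    change x ∈ LinearMap.range (ι R) ^ k at hx
    induction k generalizing x with
    | zero =>
      rw [pow_zero] at hx
      obtain ⟨r, rfl⟩ := Submodule.mem_one.1 hx
      rw [CliffordAlgebra.contractLeft_algebraMap]
      exact zero_mem _
    | succ k ih =>
      have hdeg : Int.ofNat (k + 1) - 1 = Int.ofNat k := add_sub_cancel_right (k : ℤ) 1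
      rw [pow_succ'] at hx
      rw [hdeg]
      refine Submodule.mul_induction_on hx ?_ fun y z hy hz => ?_
      · rintro _ ⟨v, rfl⟩ y hy
        change CliffordAlgebra.contractLeft φ (CliffordAlgebra.ι _ v * y) ∈ _
        rw [CliffordAlgebra.contractLeft_ι_mul]
        exact sub_mem (Submodule.smul_mem _ _ hy) (ι_mul_mem_extPow v (ih hy))
      · rw [map_add]
        exact add_mem hy hz

/-- Left multiplication by a vector `v`, as a map `⋀ʲ⁻¹ N → ⋀ʲ N`. -/
def wedge (v : N) (j : ℤ) : extPow R N (j - 1) →ₗ[R] extPow R N j :=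
  (LinearMap.mulLeft R (ExteriorAlgebra.ι R v)).restrict fun _ => ι_mul_mem_extPow v

/-- Contraction with a functional `φ`, as a map `⋀ʲ N → ⋀ʲ⁻¹ N`. -/
def contract (φ : Module.Dual R N) (j : ℤ) : extPow R N j →ₗ[R] extPow R N (j - 1) :=
  (CliffordAlgebra.contractLeft (Q := (0 : QuadraticForm R N)) φ).restrict
    fun _ => contractLeft_mem_extPow φ

lemma contract_wedge (φ : Module.Dual R N) (v : N) {j : ℤ} (x : extPow R N (j - 1)) :
    contract φ j (wedge v j x) = φ v • x - wedge v (j - 1) (contract φ (j - 1) x) :=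
  Subtype.ext (CliffordAlgebra.contractLeft_ι_mul ..)

lemma wedge_wedge (v : N) {j : ℤ} (x : extPow R N (j - 1 - 1)) :
    wedge v j (wedge v (j - 1) x) = 0 := by
  apply Subtype.ext
  change ExteriorAlgebra.ι R v * (ExteriorAlgebra.ι R v * x.1) = 0
  rw [← mul_assoc, ExteriorAlgebra.ι_sq_zero, zero_mul]

lemma wedge_zero (j : ℤ) : wedge (R := R) (0 : N) j = 0 := by
  ext x
  change ExteriorAlgebra.ι R 0 * x.1 = 0
  rw [map_zero, zero_mul]

lemma extPowMap_wedge (f : N →ₗ[R] L) (v : N) {j : ℤ} (x : extPow R N (j - 1)) :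
    extPowMap f j (wedge v j x) = wedge (f v) j (extPowMap f (j - 1) x) := by
  apply Subtype.ext
  change ExteriorAlgebra.map f (ExteriorAlgebra.ι R v * x.1) =
    ExteriorAlgebra.ι R (f v) * ExteriorAlgebra.map f x.1
  rw [map_mul, ExteriorAlgebra.map_apply_ι]

lemma extPowMap_extPowMap {L' : Type*} [AddCommGroup L'] [Module R L'] (g : L →ₗ[R] L')
    (f : N →ₗ[R] L) {j : ℤ} (x : extPow R N j) :
    extPowMap g j (extPowMap f j x) = extPowMap (g ∘ₗ f) j x := by
  apply Subtype.ext
  change ExteriorAlgebra.map g (ExteriorAlgebra.map f x.1) = ExteriorAlgebra.map (g ∘ₗ f) x.1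
  rw [← ExteriorAlgebra.map_comp_map, AlgHom.comp_apply]

lemma extPowMap_surjective {f : N →ₗ[R] L} (hf : Function.Surjective f) (j : ℤ) :
    Function.Surjective (extPowMap f j) := by
  suffices h : extPow R L j ≤ (extPow R N j).map (ExteriorAlgebra.map f).toLinearMap by
    rintro ⟨y, hy⟩
    obtain ⟨x, hx, rfl⟩ := h hy
    exact ⟨⟨x, hx⟩, rfl⟩
  cases j with
  | negSucc k => exact bot_le
  | ofNat k =>
    change LinearMap.range (ExteriorAlgebra.ι R) ^ k ≤
      (LinearMap.range (ExteriorAlgebra.ι R) ^ k).map (ExteriorAlgebra.map f).toLinearMap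
    rw [Submodule.map_pow, ExteriorAlgebra.ι_range_map_map, LinearMap.range_eq_top.2 hf,
      Submodule.map_top]

lemma extPowMap_id_sub_smulRight (φ : Module.Dual R N) (v : N) {j : ℤ} (x : extPow R N j) :
    extPowMap (LinearMap.id - φ.smulRight v) j x = x - wedge v j (contract φ j x) := by
  suffices h : ∀ y : ExteriorAlgebra R N,
      ExteriorAlgebra.map (LinearMap.id - φ.smulRight v) y =
        y - ExteriorAlgebra.ι R v *
          CliffordAlgebra.contractLeft (Q := (0 : QuadraticForm R N)) φ y from
    Subtype.ext (h x.1)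
  intro y
  induction y using CliffordAlgebra.left_induction with
  | algebraMap r =>
    rw [CliffordAlgebra.contractLeft_algebraMap, mul_zero, sub_zero]
    exact AlgHom.commutes _ r
  | add y z hy hz =>
    rw [map_add, hy, hz, (CliffordAlgebra.contractLeft φ).map_add, mul_add, add_sub_add_comm]
  | ι_mul y u hy =>
    change ExteriorAlgebra.map _ (ExteriorAlgebra.ι R u * y) =
      ExteriorAlgebra.ι R u * y - ExteriorAlgebra.ι R v *
        CliffordAlgebra.contractLeft φ (CliffordAlgebra.ι _ u * y)
    rw [CliffordAlgebra.contractLeft_ι_mul, map_mul, ExteriorAlgebra.map_apply_ι, hy]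
    set c : ExteriorAlgebra R N := CliffordAlgebra.contractLeft φ y
    change ExteriorAlgebra.ι R (u - φ u • v) * _ =
      _ - ExteriorAlgebra.ι R v * (φ u • y - ExteriorAlgebra.ι R u * c)
    have hvv : ExteriorAlgebra.ι R v * (ExteriorAlgebra.ι R v * c) = 0 := by
      rw [← mul_assoc, ExteriorAlgebra.ι_sq_zero, zero_mul]
    have huv : ExteriorAlgebra.ι R u * (ExteriorAlgebra.ι R v * c) =
        -(ExteriorAlgebra.ι R v * (ExteriorAlgebra.ι R u * c)) := by
      rw [← mul_assoc, ← mul_assoc, ← neg_mul,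
        eq_neg_of_add_eq_zero_left (ExteriorAlgebra.ι_add_mul_swap u v)]
    rw [map_sub, map_smul, sub_mul, mul_sub, mul_sub, mul_sub, smul_mul_assoc, smul_mul_assoc, hvv,
      huv, mul_smul_comm, smul_zero]
    abel

/-- The kernel of the projection `⋀ʲ N → ⋀ʲ (N / P)`. -/
def quotKer (P : Submodule R N) (j : ℤ) : Submodule R (extPow R N j) :=
  LinearMap.ker (extPowMap P.mkQ j)

variable {P Q : Submodule R N}

lemma extPowMap_eq_zero_of_mem_quotKer {f : N →ₗ[R] L} (hf : P ≤ LinearMap.ker f) {j : ℤ}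
    {x : extPow R N j} (hx : x ∈ quotKer P j) : extPowMap f j x = 0 := by
  rw [← P.liftQ_mkQ f hf, ← extPowMap_extPowMap, LinearMap.mem_ker.1 hx, map_zero]

lemma quotKer_mono (h : P ≤ Q) (j : ℤ) : quotKer P j ≤ quotKer Q j := fun _ =>
  extPowMap_eq_zero_of_mem_quotKer (by rwa [Submodule.ker_mkQ])

lemma wedge_mem_quotKer (v : N) {j : ℤ} {x : extPow R N (j - 1)} (hx : x ∈ quotKer P (j - 1)) :
    wedge v j x ∈ quotKer P j := by
  rw [quotKer, LinearMap.mem_ker, extPowMap_wedge, LinearMap.mem_ker.1 hx, map_zero]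

lemma wedge_mem_quotKer_of_mem {v : N} (hv : v ∈ P) {j : ℤ} (x : extPow R N (j - 1)) :
    wedge v j x ∈ quotKer P j := by
  rw [quotKer, LinearMap.mem_ker, extPowMap_wedge, Submodule.mkQ_apply,
    (Submodule.Quotient.mk_eq_zero P).2 hv, wedge_zero, LinearMap.zero_apply]

variable {φ : Module.Dual R N} {v : N}

lemma sub_wedge_contract_mem_quotKer (hv : φ v = 1) (hP : P ≤ LinearMap.ker φ) {j : ℤ}
    {x : extPow R N j} (hx : x ∈ quotKer (P ⊔ Submodule.span R {v}) j) :
    x - wedge v j (contract φ j x) ∈ quotKer P j := by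
  rw [← extPowMap_id_sub_smulRight, quotKer, LinearMap.mem_ker, extPowMap_extPowMap]
  refine extPowMap_eq_zero_of_mem_quotKer (sup_le (fun p hp => ?_) ?_) hx
  · simpa [LinearMap.mem_ker.1 (hP hp)] using hp
  · simp [Submodule.span_singleton_le_iff_mem, hv]

lemma quotKer_sup_span_singleton (hv : φ v = 1) (hP : P ≤ LinearMap.ker φ) (j : ℤ) :
    quotKer (P ⊔ Submodule.span R {v}) j = quotKer P j ⊔ LinearMap.range (wedge v j) := by
  refine le_antisymm (fun x hx => ?_) (sup_le (quotKer_mono le_sup_left j) ?_)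
  · exact Submodule.mem_sup.2 ⟨_, sub_wedge_contract_mem_quotKer hv hP hx, _,
      LinearMap.mem_range_self _ _, sub_add_cancel _ _⟩
  · rintro _ ⟨y, rfl⟩
    exact wedge_mem_quotKer_of_mem
      (Submodule.mem_sup_right (Submodule.mem_span_singleton_self v)) y

lemma comap_wedge_quotKer (hv : φ v = 1) (hP : P ≤ LinearMap.ker φ) (j : ℤ) :
    (quotKer P j).comap (wedge v j) = quotKer (P ⊔ Submodule.span R {v}) (j - 1) := by
  apply le_antisymm
  · intro x hx
    let π := Submodule.factor (le_sup_left : P ≤ P ⊔ Submodule.span R {v})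
    have hwedge : wedge (P.mkQ v) j (extPowMap P.mkQ (j - 1) x) = 0 := by
      rw [← extPowMap_wedge]
      exact hx
    have hmem : extPowMap P.mkQ (j - 1) x =
        wedge (P.mkQ v) (j - 1) (contract (P.liftQ φ hP) (j - 1) (extPowMap P.mkQ (j - 1) x)) := by
      have h := contract_wedge (P.liftQ φ hP) (P.mkQ v) (extPowMap P.mkQ (j - 1) x)
      rw [hwedge, map_zero, Submodule.mkQ_apply, Submodule.liftQ_apply, hv, one_smul] at h
      exact sub_eq_zero.1 h.symm
    have hπ : π (P.mkQ v) = 0 := (Submodule.Quotient.mk_eq_zero _).2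
      (Submodule.mem_sup_right (Submodule.mem_span_singleton_self v))
    rw [quotKer, LinearMap.mem_ker, ← Submodule.factor_comp_mk le_sup_left, ← extPowMap_extPowMap,
      hmem, extPowMap_wedge, hπ, wedge_zero, LinearMap.zero_apply]
  · intro x hx
    have h := wedge_mem_quotKer v (sub_wedge_contract_mem_quotKer hv hP hx)
    rwa [map_sub, wedge_wedge, sub_zero] at h

end ExteriorPowers

section Coboundary

variable (R : Type v) [CommRing R] {E : Type u} [LinearOrder E]
  {L L' : Type*} [AddCommGroup L'] [Module R L'] [AddCommGroup L] [Module R L]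

/-- The simplicial coboundary of functions on the finite subsets of `E`, with the signs of the
differential `d`. -/
def coboundary : (Finset E → L) →ₗ[R] (Finset E → L) :=
  LinearMap.pi fun T => ∑ f ∈ T, edgeSign R (T.erase f) f • LinearMap.proj (T.erase f)

lemma coboundary_apply (x : Finset E → L) (T : Finset E) :
    coboundary R x T = ∑ f ∈ T, edgeSign R (T.erase f) f • x (T.erase f) := by
  simp [coboundary]

lemma coboundary_congr {x y : Finset E → L} {T : Finset E} (h : ∀ S ⊆ T, x S = y S) :
    coboundary R x T = coboundary R y T := by
  simp only [coboundary_apply, h _ (Finset.erase_subset _ T)]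

lemma coboundary_comp (g : L →ₗ[R] L') (x : Finset E → L) (T : Finset E) :
    coboundary R (g ∘ x) T = g (coboundary R x T) := by
  simp [coboundary_apply]

variable {R} in
lemma coboundary_mem {P : Submodule R L} {x : Finset E → L} {T : Finset E}
    (h : ∀ f ∈ T, x (T.erase f) ∈ P) : coboundary R x T ∈ P := by
  rw [coboundary_apply]
  exact Submodule.sum_mem _ fun f hf => Submodule.smul_mem _ _ (h f hf)

/-- The signed link at `e`: by `link_coboundary`, it is a contracting homotopy of `coboundary`
when `e` is the largest element. -/
def link (e : E) : (Finset E → L) →ₗ[R] (Finset E → L) :=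
  LinearMap.pi fun S => (-1 : R) ^ S.card • LinearMap.proj (insert e S)

lemma link_apply (e : E) (x : Finset E → L) (S : Finset E) :
    link R e x S = (-1 : R) ^ S.card • x (insert e S) := rfl

variable {R} in
lemma link_mem_iff {P : Submodule R L} {e : E} {x : Finset E → L} {S : Finset E} :
    link R e x S ∈ P ↔ x (insert e S) ∈ P :=
  P.smul_mem_iff_of_isUnit (isUnit_one.neg.pow _)

lemma link_coboundary (x : Finset E → L) {S : Finset E} {e : E} (h : ∀ f ∈ S, f < e) :
    link R e (coboundary R x) S = x S - coboundary R (link R e x) S := by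
  have he : e ∉ S := fun he => lt_irrefl _ (h e he)
  have hsign (n : ℕ) : (-1 : R) ^ n * (-1) ^ n = 1 := by
    rw [← mul_pow, neg_one_mul, neg_neg, one_pow]
  rw [link_apply, coboundary_apply, Finset.sum_insert he, Finset.erase_insert he, smul_add,
    edgeSign, Finset.filter_true_of_mem h, smul_smul, hsign, one_smul, sub_eq_add_neg,
    coboundary_apply, Finset.smul_sum, ← Finset.sum_neg_distrib]
  congr 1
  refine Finset.sum_congr rfl fun f hf => ?_
  have hfilter : (insert e (S.erase f)).filter (· < f) = (S.erase f).filter (· < f) := by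
    rw [Finset.filter_insert, if_neg (h f hf).not_gt]
  rw [Finset.erase_insert_of_ne (h f hf).ne', link_apply, edgeSign, hfilter, ← edgeSign,
    ← Finset.card_erase_add_one hf, pow_succ, mul_neg_one, neg_smul, smul_comm]

lemma exists_link_eq (e : E) (y z : Finset E → L) :
    ∃ x : Finset E → L, ∀ S, e ∉ S → x S = y S ∧ link R e x S = z S := by
  refine ⟨fun S => if e ∈ S then (-1 : R) ^ (S.erase e).card • z (S.erase e) else y S,
    fun S he => ⟨if_neg he, ?_⟩⟩
  rw [link_apply, if_pos (Finset.mem_insert_self e S), Finset.erase_insert he, smul_smul,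
    ← mul_pow, neg_one_mul, neg_neg, one_pow, one_smul]

lemma coboundary_coboundary (x : Finset E → L) (T : Finset E) :
    coboundary R (coboundary R x) T = 0 := by
  induction T using Finset.induction_on_max generalizing x with
  | empty => rw [coboundary_apply, Finset.sum_empty]
  | insert e T hT ih =>
    rw [← Submodule.mem_bot R, ← link_mem_iff, Submodule.mem_bot, link_coboundary R _ hT,
      coboundary_congr R (y := x - coboundary R (link R e x))
        fun S hS => link_coboundary R x fun f hf => hT f (hS hf),
      map_sub, Pi.sub_apply, ih, sub_zero, sub_self]

end Coboundary

section Exactness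

variable {R : Type v} [CommRing R] {E : Type u} [LinearOrder E]
  {L L' : Type*} [AddCommGroup L'] [Module R L'] [AddCommGroup L] [Module R L]

/-- Exactness in degree `i` of the complex `⨁_{S ⊆ B} L / K S` with the differential induced by
`coboundary`, expressed by lifts of cochains to `L`. -/
def IsExactAt (K : Finset E → Submodule R L) (B : Finset E) (i : ℤ) : Prop :=
  ∀ x : Finset E → L, (∀ T ⊆ B, (T.card : ℤ) = i + 1 → coboundary R x T ∈ K T) →
    ∃ y : Finset E → L, ∀ S ⊆ B, (S.card : ℤ) = i → x S - coboundary R y S ∈ K S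

lemma forall_subset_insert_card_eq_iff {p : Finset E → Prop} {B : Finset E} {e : E} (he : e ∉ B)
    {i : ℤ} :
    (∀ S ⊆ insert e B, (S.card : ℤ) = i → p S) ↔
      (∀ S ⊆ B, (S.card : ℤ) = i → p S) ∧
        ∀ S ⊆ B, (S.card : ℤ) = i - 1 → p (insert e S) := by
  have hcard {S : Finset E} (hS : S ⊆ B) : ((insert e S).card : ℤ) = i ↔ (S.card : ℤ) = i - 1 := by
    rw [Finset.card_insert_of_notMem fun h => he (hS h), Nat.cast_succ, eq_sub_iff_add_eq]
  refine ⟨fun h => ⟨fun S hS => h S (hS.trans (Finset.subset_insert e B)), fun S hS hi =>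
    h _ (Finset.insert_subset_insert e hS) ((hcard hS).2 hi)⟩, fun h S hS hi => ?_⟩
  by_cases heS : e ∈ S
  · have hT : S.erase e ⊆ B := Finset.subset_insert_iff.1 hS
    rw [← Finset.insert_erase heS] at hi ⊢
    exact h.2 _ hT ((hcard hT).1 hi)
  · exact h.1 S ((Finset.subset_insert_iff_of_notMem heS).1 hS) hi

variable {K : Finset E → Submodule R L} {B : Finset E} {e : E} {i : ℤ}

lemma isExactAt_insert (hK : Monotone K) (hB : ∀ f ∈ B, f < e) (hdel : IsExactAt K B i)
    (hcon : IsExactAt (fun S => K (insert e S)) B (i - 1)) : IsExactAt K (insert e B) i := by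
  intro x hx
  have he : e ∉ B := fun h => lt_irrefl e (hB e h)
  obtain ⟨hxB, hxe⟩ := (forall_subset_insert_card_eq_iff he).1 hx
  obtain ⟨y, hy⟩ := hdel x hxB
  have hcocycle : ∀ T ⊆ B, (T.card : ℤ) = i - 1 + 1 →
      coboundary R (link R e x - y) T ∈ K (insert e T) := by
    intro T hT hi
    have hlink := link_coboundary R x fun f hf => hB f (hT hf)
    have heq : coboundary R (link R e x - y) T =
        (x T - coboundary R y T) - link R e (coboundary R x) T := by
      rw [hlink, map_sub, Pi.sub_apply]
      abel
    rw [heq]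
    exact sub_mem (hK (Finset.subset_insert e T) (hy T hT (by omega)))
      (link_mem_iff.2 (hxe T hT (by omega)))
  obtain ⟨z, hz⟩ := hcon _ hcocycle
  obtain ⟨w, hw⟩ := exists_link_eq R e y (-z)
  refine ⟨w, (forall_subset_insert_card_eq_iff he).2 ⟨fun S hS hi => ?_, fun S hS hi => ?_⟩⟩
  · rw [coboundary_congr R fun T hT => (hw T fun h => he (hS (hT h))).1]
    exact hy S hS hi
  · have hlink : link R e (x - coboundary R w) S = (link R e x - y) S - coboundary R z S := by
      rw [map_sub, Pi.sub_apply, link_coboundary R w fun f hf => hB f (hS hf),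
        coboundary_congr R fun T hT => (hw T fun h => he (hS (hT h))).2,
        (hw S fun h => he (hS h)).1, map_neg, Pi.neg_apply, Pi.sub_apply]
      abel
    exact link_mem_iff.1 (hlink ▸ hz S hS hi)

lemma exists_sub_comp_mem_of_coloop (hB : ∀ f ∈ B, f < e) {m : L' →ₗ[R] L}
    (hsup : ∀ S ⊆ B, K (insert e S) = K S ⊔ LinearMap.range m) {x : Finset E → L}
    (hx : ∀ S ⊆ B, (S.card : ℤ) = i → coboundary R x (insert e S) ∈ K (insert e S)) :
    ∃ w : Finset E → L', ∀ S ⊆ B, (S.card : ℤ) = i →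
      (x - coboundary R (link R e x) - m ∘ w) S ∈ K S := by
  have hlift : ∀ S, ∃ w, S ⊆ B → (S.card : ℤ) = i →
      x S - coboundary R (link R e x) S - m w ∈ K S := by
    intro S
    by_cases hS : S ⊆ B ∧ (S.card : ℤ) = i
    · have hmem : link R e (coboundary R x) S ∈ K S ⊔ LinearMap.range m := by
        rw [← hsup S hS.1]
        exact link_mem_iff.2 (hx S hS.1 hS.2)
      obtain ⟨k, hk, _, ⟨w, rfl⟩, hkw⟩ := Submodule.mem_sup.1 hmem
      refine ⟨w, fun _ _ => ?_⟩
      rwa [← link_coboundary R x fun f hf => hB f (hS.1 hf), ← hkw, add_sub_cancel_right]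
    · exact ⟨0, fun hSB hi => absurd ⟨hSB, hi⟩ hS⟩
  choose w hw using hlift
  exact ⟨w, hw⟩

lemma isExactAt_insert_of_coloop (hK : Monotone K) (hB : ∀ f ∈ B, f < e)
    {K' : Finset E → Submodule R L'} {m : L' →ₗ[R] L} (hcomap : ∀ S ⊆ B, (K S).comap m = K' S)
    (hsup : ∀ S ⊆ B, K (insert e S) = K S ⊔ LinearMap.range m) (hcon : IsExactAt K' B i) :
    IsExactAt K (insert e B) i := by
  intro x hx
  have he : e ∉ B := fun h => lt_irrefl e (hB e h)
  obtain ⟨hxB, hxe⟩ := (forall_subset_insert_card_eq_iff he).1 hx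
  rw [add_sub_cancel_right] at hxe
  obtain ⟨w, hw⟩ := exists_sub_comp_mem_of_coloop hB hsup hxe
  have hcocycle : ∀ T ⊆ B, (T.card : ℤ) = i + 1 → coboundary R w T ∈ K' T := by
    intro T hT hi
    have hdiff : coboundary R (x - coboundary R (link R e x) - m ∘ w) T ∈ K T := by
      refine coboundary_mem fun f hf => hK (Finset.erase_subset f T)
        (hw _ ((Finset.erase_subset f T).trans hT) ?_)
      have hcard := Finset.card_erase_add_one hf
      omega
    rw [map_sub, Pi.sub_apply, map_sub, Pi.sub_apply, coboundary_coboundary, sub_zero,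
      coboundary_comp] at hdiff
    rw [← hcomap T hT, Submodule.mem_comap]
    exact (Submodule.sub_mem_iff_right _ (hxB T hT hi)).1 hdiff
  obtain ⟨z, hz⟩ := hcon w hcocycle
  obtain ⟨y, hy⟩ := exists_link_eq R e (link R e x + m ∘ z) 0
  refine ⟨y, (forall_subset_insert_card_eq_iff he).2 ⟨fun S hS hi => ?_, fun S hS _ => ?_⟩⟩
  · have heq : x S - coboundary R y S =
        (x - coboundary R (link R e x) - m ∘ w) S + m (w S - coboundary R z S) := by
      rw [coboundary_congr R fun T hT => (hy T fun h => he (hS (hT h))).1, map_add, Pi.add_apply,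
        coboundary_comp, map_sub]
      simp only [Pi.sub_apply, Function.comp_apply]
      abel
    rw [heq]
    refine add_mem (hw S hS hi) ?_
    rw [← Submodule.mem_comap, hcomap S hS]
    exact hz S hS hi
  · have hlink : link R e (x - coboundary R y) S = -m (z S) := by
      rw [map_sub, Pi.sub_apply, link_coboundary R y fun f hf => hB f (hS hf),
        coboundary_congr R fun T hT => (hy T fun h => he (hS (hT h))).2,
        (hy S fun h => he (hS h)).1, map_zero, Pi.zero_apply, Pi.add_apply, Function.comp_apply]
      abel
    have hmem : link R e (x - coboundary R y) S ∈ K (insert e S) := by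
      rw [hlink, hsup S hS, ← map_neg]
      exact Submodule.mem_sup_right (LinearMap.mem_range_self m _)
    exact link_mem_iff.1 hmem

lemma isExactAt_quotKer_of_neg (P : Finset E → Submodule R L) {j : ℤ} (h : i + j < 0) :
    IsExactAt (fun S => quotKer (P S) j) B i := by
  intro x _
  refine ⟨0, fun S _ hS => ?_⟩
  obtain ⟨k, rfl⟩ := Int.eq_negSucc_of_lt_zero (show j < 0 by omega)
  have hx : x S = 0 := Subtype.ext ((Submodule.mem_bot R).1 (x S).2)
  rw [hx, map_zero, Pi.zero_apply, sub_zero]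
  exact zero_mem _

end Exactness

section Vanishing

lemma exists_dual_eq_one {R : Type v} [CommRing R] [IsDomain R] {N : Type w} [AddCommGroup N]
    [Module R N] {P : Submodule R N} {v : N} (hv : v ∉ P) [Module.IsTorsionFree R (N ⧸ P)]
    [Module.Projective R (N ⧸ P ⊔ Submodule.span R {v})] :
    ∃ φ : Module.Dual R N, φ v = 1 ∧ P ≤ LinearMap.ker φ := by
  set Q := P ⊔ Submodule.span R {v} with hQ
  obtain ⟨s, hs⟩ := Module.projective_lifting_property Q.mkQ LinearMap.id Q.mkQ_surjective
  let g : N →ₗ[R] N ⧸ P := P.mkQ ∘ₗ (LinearMap.id - s ∘ₗ Q.mkQ)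
  have hg {x : N} (hx : x ∈ Q) : g x = P.mkQ x := by
    simp [g, (Submodule.Quotient.mk_eq_zero Q).2 hx]
  have hmap : Q.map P.mkQ = Submodule.span R {P.mkQ v} := by
    rw [hQ, Submodule.map_sup, Submodule.mkQ_map_self, bot_sup_eq, Submodule.map_span,
      Set.image_singleton]
  have hspan (x : N) : g x ∈ Submodule.span R {P.mkQ v} := by
    rw [← hmap]
    refine Submodule.mem_map_of_mem ((Submodule.Quotient.mk_eq_zero Q).1 ?_)
    exact (map_sub Q.mkQ x _).trans (sub_eq_zero.2 (LinearMap.congr_fun hs (Q.mkQ x)).symm)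
  have hne : P.mkQ v ≠ 0 := fun h => hv ((Submodule.Quotient.mk_eq_zero P).1 h)
  refine ⟨(LinearEquiv.coord R (N ⧸ P) (P.mkQ v) hne).toLinearMap ∘ₗ g.codRestrict _ hspan, ?_,
    fun p hp => ?_⟩
  · have hgv : g.codRestrict _ hspan v = ⟨P.mkQ v, Submodule.mem_span_singleton_self _⟩ :=
      Subtype.ext (hg (Submodule.mem_sup_right (Submodule.mem_span_singleton_self v)))
    rw [LinearMap.comp_apply, hgv]
    exact LinearEquiv.coord_self ..
  · have hgp : g.codRestrict _ hspan p = 0 :=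
      Subtype.ext ((hg (Submodule.mem_sup_left hp)).trans
        ((Submodule.Quotient.mk_eq_zero P).2 hp))
    rw [LinearMap.mem_ker, LinearMap.comp_apply, hgp, map_zero]

variable {R : Type v} [CommRing R] [IsDomain R] [IsPrincipalIdealRing R]
  {E : Type u} [Fintype E] [LinearOrder E] {M : RankMatroid E}
  {N : Type w} [AddCommGroup N] [Module R N] [Module.Finite R N] {ρ : QuasiRep R M N}

lemma exists_sub_singleton_eq_span (htf : ∀ S, Module.IsTorsionFree R (N ⧸ ρ.sub S)) (e : E) :
    ∃ v : N, ρ.sub {e} = Submodule.span R {v} := by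
  have : Module.IsTorsionFree R (N ⧸ ρ.sub ∅) := htf ∅
  let q := ((ρ.sub ∅).quotEquivOfEqBot ρ.sub_empty).symm
  have : Module.IsTorsionFree R N := q.injective.moduleIsTorsionFree q (map_smul q)
  have hrank : Module.finrank R (ρ.sub {e}) ≤ 1 :=
    (ρ.finrank_sub {e}).trans_le (M.rk_le_card {e})
  obtain ⟨v, hv⟩ := (Submodule.finrank_le_one_iff_isPrincipal (ρ.sub {e})).1 hrank
  exact ⟨v, hv⟩

lemma exists_dual_of_rk_insert_ne (hsup : ∀ S T, ρ.sub (S ∪ T) = ρ.sub S ⊔ ρ.sub T)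
    (htf : ∀ S, Module.IsTorsionFree R (N ⧸ ρ.sub S)) {S : Finset E} {e : E}
    (hne : M.rk (insert e S) ≠ M.rk S) :
    ∃ (v : N) (φ : Module.Dual R N), (∀ T, ρ.sub (insert e T) = ρ.sub T ⊔ Submodule.span R {v}) ∧
      φ v = 1 ∧ ρ.sub S ≤ LinearMap.ker φ := by
  obtain ⟨v, hv⟩ := exists_sub_singleton_eq_span htf e
  have hinsert (T : Finset E) : ρ.sub (insert e T) = ρ.sub T ⊔ Submodule.span R {v} := by
    rw [Finset.insert_eq, hsup, hv, sup_comm]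
  have hvS : v ∉ ρ.sub S := fun h => hne <| by
    rw [← ρ.finrank_sub, ← ρ.finrank_sub, hinsert,
      sup_eq_left.2 ((Submodule.span_singleton_le_iff_mem v _).2 h)]
  have := htf S
  have := htf (insert e S)
  have : Module.Projective R (N ⧸ ρ.sub S ⊔ Submodule.span R {v}) := by
    rw [← hinsert]
    infer_instance
  exact ⟨v, (exists_dual_eq_one hvS).imp fun _ => And.intro hinsert⟩

lemma isExactAt_quotKer_of_lt_rk (hsup : ∀ S T, ρ.sub (S ∪ T) = ρ.sub S ⊔ ρ.sub T)
    (htf : ∀ S, Module.IsTorsionFree R (N ⧸ ρ.sub S)) (A B : Finset E) {i j : ℤ}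
    (h : i + j + M.rk A < M.rk (A ∪ B)) :
    IsExactAt (fun S => quotKer (ρ.sub (A ∪ S)) j) B i := by
  induction B using Finset.induction_on_max generalizing A i j with
  | empty =>
    rw [Finset.union_empty] at h
    exact isExactAt_quotKer_of_neg _ (by omega)
  | insert e B hB ih =>
    have hmono : Monotone fun S => quotKer (ρ.sub (A ∪ S)) j := fun S T hST =>
      quotKer_mono (ρ.sub_mono (Finset.union_subset_union_right hST)) j
    have hA : M.rk (insert e A) ≤ M.rk A + 1 := by
      have hsubmod := M.rk_submod A {e}
      have hcard := M.rk_le_card {e}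
      rw [Finset.card_singleton] at hcard
      rw [Finset.union_comm, ← Finset.insert_eq] at hsubmod
      omega
    rw [Finset.union_insert] at h
    by_cases hr : M.rk (insert e (A ∪ B)) = M.rk (A ∪ B)
    · have hcon := ih (insert e A) (i := i - 1) (j := j) (by rw [Finset.insert_union]; omega)
      simp only [Finset.insert_union, ← Finset.union_insert] at hcon
      exact isExactAt_insert hmono hB (ih A (by omega)) hcon
    · obtain ⟨v, φ, hinsert, hv, hφ⟩ := exists_dual_of_rk_insert_ne hsup htf hr
      have hφS {S : Finset E} (hS : S ⊆ B) : ρ.sub (A ∪ S) ≤ LinearMap.ker φ :=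
        (ρ.sub_mono (Finset.union_subset_union_right hS)).trans hφ
      refine isExactAt_insert_of_coloop hmono hB (m := wedge v j) (fun S hS => ?_)
        (fun S hS => ?_) (ih (insert e A) (i := i) (j := j - 1) ?_)
      · rw [comap_wedge_quotKer hv (hφS hS), ← hinsert, Finset.insert_union]
      · rw [Finset.union_insert, hinsert, quotKer_sup_span_singleton hv (hφS hS)]
      · rw [Finset.insert_union]
        omega

variable (ρ) in
/-- The cochain in `C^{i,j}` whose component at `S` is the image in `⋀ʲ (N / ρ(S))` of the value
at `S` of a function with values in `⋀ʲ N`. -/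
def cochainMk (i j : ℤ) : (Finset E → extPow R N j) →ₗ[R] Cochain ρ i j :=
  LinearMap.pi fun S => extPowMap (ρ.sub S.1).mkQ j ∘ₗ LinearMap.proj S.1

lemma cochainMk_surjective (i j : ℤ) : Function.Surjective (cochainMk ρ i j) := by
  intro x
  have hlift : ∀ S : Finset E, ∃ y, ∀ hS : (S.card : ℤ) = i,
      extPowMap (ρ.sub S).mkQ j y = x ⟨S, hS⟩ := by
    intro S
    by_cases hS : (S.card : ℤ) = i
    · obtain ⟨y, hy⟩ := extPowMap_surjective (ρ.sub S).mkQ_surjective j (x ⟨S, hS⟩)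
      exact ⟨y, fun _ => hy⟩
    · exact ⟨0, fun h => absurd h hS⟩
  choose y hy using hlift
  exact ⟨y, funext fun S => hy S.1 S.2⟩

lemma cochainMk_eq_zero_iff {i j : ℤ} {x : Finset E → extPow R N j} :
    cochainMk ρ i j x = 0 ↔ ∀ S : Finset E, (S.card : ℤ) = i → x S ∈ quotKer (ρ.sub S) j :=
  ⟨fun h S hS => congrFun h ⟨S, hS⟩, fun h => funext fun S => h S.1 S.2⟩

lemma d_cochainMk {i i' j : ℤ} (h : i + 1 = i') (x : Finset E → extPow R N j) :
    d ρ i i' j h (cochainMk ρ i j x) = cochainMk ρ i' j (coboundary R x) := by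
  funext T
  apply Subtype.ext
  rw [d_apply_coe]
  change _ = (extPowMap (ρ.sub T.1).mkQ j (coboundary R x T.1)).1
  rw [coboundary_apply, map_sum, Submodule.coe_sum, ← Finset.sum_coe_sort T.1]
  refine Finset.sum_congr rfl fun e _ => ?_
  rw [map_smul, Submodule.coe_smul]
  congr 1
  exact congrArg Subtype.val (extPowMap_extPowMap _ _ _)

end Vanishing

section Graphic

variable {α : Type u} {β : Type v} (G : Graph α β) [Finite G.vertexSet] [LinearOrder G.vertexSet]
  [Fintype G.edgeSet]

lemma mem_edgeSpan_sup_rootSpan_of_smul_mem {S : Finset G.edgeSet} {m : ℤ} (hm : m ≠ 0)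
    {z : G.vertexSet →₀ ℤ} (hz : m • z ∈ edgeSpan G S ⊔ rootSpan G) :
    z ∈ edgeSpan G S ⊔ rootSpan G := by
  have htop : z ∈ edgeSpan G Finset.univ ⊔ rootSpan G := by
    rw [edgeSpan_sup_rootSpan]
    exact Submodule.mem_top
  obtain ⟨u, hu, r, hr, rfl⟩ := Submodule.mem_sup.1 htop
  obtain ⟨s, hs, t, ht, hst⟩ := Submodule.mem_sup.1 hz
  have hdiff : m • u - s = t - m • r := by
    rw [sub_eq_sub_iff_add_eq_add, ← smul_add, ← hst, add_comm]
  have hzero : m • u - s = 0 := by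
    rw [← Submodule.mem_bot ℤ, ← edgeSpan_inf_rootSpan G Finset.univ]
    exact ⟨sub_mem (Submodule.smul_mem _ m hu) (edgeSpan_mono G (Finset.subset_univ S) hs),
      hdiff ▸ sub_mem ht (Submodule.smul_mem _ m hr)⟩
  have hmu : m • u ∈ edgeSpan G S := sub_eq_zero.1 hzero ▸ hs
  refine add_mem (Submodule.mem_sup_left ?_) (Submodule.mem_sup_right hr)
  rw [edgeSpan_eq_ker, LinearMap.mem_ker] at hmu ⊢
  rw [map_smul] at hmu
  exact (smul_eq_zero.1 hmu).resolve_left hm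

variable [DecidableEq G.edgeSet]

lemma canonicalRep_sub_union (S T : Finset G.edgeSet) :
    (canonicalRep G).sub (S ∪ T) = (canonicalRep G).sub S ⊔ (canonicalRep G).sub T := by
  change (edgeSpan G (S ∪ T)).map _ = _
  rw [edgeSpan_union, Submodule.map_sup]
  rfl

lemma isTorsionFree_quotient_canonicalRep (S : Finset G.edgeSet) : Module.IsTorsionFree ℤ
    (((G.vertexSet →₀ ℤ) ⧸ rootSpan G) ⧸ (canonicalRep G).sub S) := by
  have hmem (z : G.vertexSet →₀ ℤ) : (rootSpan G).mkQ z ∈ (canonicalRep G).sub S ↔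
      z ∈ edgeSpan G S ⊔ rootSpan G := by
    change z ∈ ((edgeSpan G S).map (rootSpan G).mkQ).comap (rootSpan G).mkQ ↔ _
    rw [Submodule.comap_map_mkQ, sup_comm]
  refine .of_smul_eq_zero fun m x hmx => or_iff_not_imp_left.2 fun hm => ?_
  obtain ⟨y, rfl⟩ := Submodule.mkQ_surjective _ x
  obtain ⟨z, rfl⟩ := Submodule.mkQ_surjective _ y
  refine (Submodule.Quotient.mk_eq_zero _).2 ((hmem z).2 ?_)
  refine mem_edgeSpan_sup_rootSpan_of_smul_mem G hm ((hmem (m • z)).1 ?_)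
  rw [map_smul]
  exact (Submodule.Quotient.mk_eq_zero _).1 hmx

end Graphic

end

end CharCoh

open CharCoh in
theorem corollary6p6_general {R : Type*} [CommRing R] [IsDomain R] [IsPrincipalIdealRing R]
    {E : Type*} [Fintype E] [LinearOrder E] {M : RankMatroid E}
    {N : Type*} [AddCommGroup N] [Module R N] [Module.Finite R N] (ρ : QuasiRep R M N)
    (hsup : ∀ S T, ρ.sub (S ∪ T) = ρ.sub S ⊔ ρ.sub T)
    (htf : ∀ S, Module.IsTorsionFree R (N ⧸ ρ.sub S))
    {i j : ℤ} (h : i + j < M.rk Finset.univ) : Subsingleton (Cohomology ρ i j) := by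
  rw [Submodule.Quotient.subsingleton_iff, Submodule.submoduleOf_eq_top]
  intro x hx
  obtain ⟨x, rfl⟩ := cochainMk_surjective i j x
  have hexact : IsExactAt (fun S => quotKer (ρ.sub S) j) Finset.univ i := by
    have hempty : M.rk ∅ = 0 := Nat.le_zero.1 (M.rk_le_card ∅)
    simpa only [Finset.empty_union] using
      isExactAt_quotKer_of_lt_rk hsup htf ∅ Finset.univ (i := i) (j := j)
        (by rw [hempty, Finset.empty_union]; simpa using h)
  rw [LinearMap.mem_ker, d_cochainMk, cochainMk_eq_zero_iff] at hx
  obtain ⟨y, hy⟩ := hexact x fun T _ => hx T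
  refine ⟨cochainMk ρ (i - 1) j y, ?_⟩
  rw [d_cochainMk, eq_comm, ← sub_eq_zero, ← map_sub, cochainMk_eq_zero_iff]
  exact fun S => hy S (Finset.subset_univ S)

theorem corollary6p6 {α β : Type*} (G : Graph α β)
    [Finite G.vertexSet] [LinearOrder G.vertexSet]
    [Fintype G.edgeSet] [LinearOrder G.edgeSet]
    (n : ℕ) (hn : n + CharCoh.numConn G Finset.univ = Nat.card G.vertexSet + 1)
    (i j : ℤ) (hij : i + j < (n : ℤ) - 1) :
    Nonempty (CharCoh.graphicCohomology G i j ≃ₗ[ℤ]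
      CharCoh.graphicCohomology G (i + 1) (j - 1)) := by
  have hrank := CharCoh.graphicRank_add_numConn G Finset.univ
  have vanish (a b : ℤ) (h : a + b < (CharCoh.graphicRank G Finset.univ : ℤ)) :
      Subsingleton (CharCoh.graphicCohomology G a b) :=
    corollary6p6_general _ (CharCoh.canonicalRep_sub_union G)
      (CharCoh.isTorsionFree_quotient_canonicalRep G) h
  have := vanish i j (by omega)
  have := vanish (i + 1) (j - 1) (by omega)
  exact ⟨LinearEquiv.ofSubsingleton _ _⟩
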